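/- Let $\mathcal I$ be a finite scwol, that is, a category with finitely many objects and finitely many morphisms in which every endomorphism is an identity. Then $\mathcal I$ admits a finite $\mathcal I$-$CW$-model for its classifying $\mathcal I$-space: there exists a finite contravariant $\mathcal I$-$CW$-complex $X$ such that $X(i)$ is contractible for every object $i$ of $\mathcal I$. Here a contravariant $\mathcal I$-space is a functor from $\mathcal I^{\mathrm{op}}$ to the category of compactly generated (Hausdorff) spaces, and maps of $\mathcal I$-spaces are natural transformations. A contravariant $\mathcal I$-$CW$-complex is an $\mathcal I$-space $X$ together with a filtration $\emptyset = X_{-1} \subset X_0 \subset X_1 \subset \cdots \subset X$ by $\mathcal I$-subspaces such that $X = \operatorname{colim}_n X_n$ and, for every $n \ge 0$, there are a set $\Lambda_n$, objects $i_\lambda$ ($\lambda \in \Lambda_n$) of $\mathcal I$, and a pushout of $\mathcal I$-spaces $$\begin{array}{ccc} \coprod_{\lambda\in\Lambda_n} \mathrm{mor}_{\mathcal I}(-,i_\lambda)\times S^{n-1} & \longrightarrow & X_{n-1} \\ \downarrow & & \downarrow \\ \coprod_{\lambda\in\Lambda_n} \mathrm{mor}_{\mathcal I}(-,i_\lambda)\times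 D^{n} & \longrightarrow & X_n \end{array}$$ whose vertical maps are the inclusions, where the morphism sets carry the discrete topology. It is finite if $X = X_n$ for some $n$ and every $\Lambda_n$ is finite. -/

import Mathlib

open CategoryTheory CategoryTheory.Limits HomotopicalAlgebra Topology

universe u

/-- A scwol (small category without loops): a small category in which every endomorphism is
an identity. -/
class IsScwol (I : Type u) [SmallCategory I] : Prop where
  endo_eq_id : ∀ {i : I} (f : i ⟶ i), f = 𝟙 i

/-- The property of being a compactly generated space in Steenrod's sense:
a Hausdorff space which is compactly generated. -/
def isSteenrodSpace : ObjectProperty TopCat.{u} :=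
  fun X => T2Space X ∧ CompactlyGeneratedSpace X

/-- The category of compactly generated (Hausdorff) spaces and continuous maps. -/
abbrev Spaces : Type (u + 1) := isSteenrodSpace.{u}.FullSubcategory

/-- A contravariant `I`-space: a contravariant functor from `I` to compactly generated spaces.
Maps of `I`-spaces are natural transformations. -/
abbrev ISpace (I : Type u) [SmallCategory I] : Type (u + 1) := Iᵒᵖ ⥤ Spaces.{u}

section Cells

variable {I : Type u} [SmallCategory I]

/-- The product of a discrete space with a compact Hausdorff space is a compactly generated
Hausdorff space (so the product topology is also the product in `Spaces`). -/
theorem isSteenrodSpace_discrete_prod (T : Type u) (K : TopCat.{u})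
    [CompactSpace K] [T2Space K] :
    isSteenrodSpace (TopCat.of (TopCat.discrete.obj T × K)) := by
  constructor
  · change T2Space (TopCat.discrete.obj T × K)
    infer_instance
  · change CompactlyGeneratedSpace (TopCat.discrete.obj T × K)
    have : T2Space (TopCat.discrete.obj T) := inferInstance
    have : WeaklyLocallyCompactSpace (TopCat.discrete.obj T × K) := inferInstance
    infer_instance

/-- The `I`-space `mor_I(?, i) × K` for a compact Hausdorff space `K`, where the morphism sets
are discrete and `I` acts by precomposition. -/
def morProd (i : I) (K : TopCat.{u}) [CompactSpace K] [T2Space K] : ISpace I where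
  obj j := ⟨TopCat.of (TopCat.discrete.obj (j.unop ⟶ i) × K),
    isSteenrodSpace_discrete_prod _ K⟩
  map {j k} f := ObjectProperty.homMk (TopCat.ofHom
    ((TopCat.discrete.map (↾fun g : j.unop ⟶ i => f.unop ≫ g)).hom.prodMap
      (ContinuousMap.id K)))
  map_id j := by
    ext x
    · exact Category.id_comp (X := j.unop) (Y := i) x.1
    · rfl
  map_comp {j k l} f g := by
    ext x
    · exact Category.assoc g.unop f.unop (show j.unop ⟶ i from x.1)
    · rfl

/-- The map of `I`-spaces `mor_I(?, i) × K ⟶ mor_I(?, i) × L` induced by a map `K ⟶ L`. -/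
def morProdMap (i : I) {K L : TopCat.{u}} [CompactSpace K] [T2Space K] [CompactSpace L]
    [T2Space L] (φ : K ⟶ L) : morProd i K ⟶ morProd i L where
  app j := ObjectProperty.homMk (TopCat.ofHom
    ((ContinuousMap.id (TopCat.discrete.obj (j.unop ⟶ i))).prodMap φ.hom))
  naturality _ _ _ := rfl

instance (n : ℕ) : T2Space (TopCat.disk.{u} n) :=
  inferInstanceAs (T2Space (ULift (Metric.closedBall (0 : EuclideanSpace ℝ (Fin n)) 1)))

instance (n : ℕ) : T2Space (TopCat.diskBoundary.{u} n) :=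
  inferInstanceAs (T2Space (ULift (Metric.sphere (0 : EuclideanSpace ℝ (Fin n)) 1)))

/-- The family, indexed by the objects `i` of `I`, of the inclusions
`mor_I(?, i) × S^{n-1} ⟶ mor_I(?, i) × D^n`. -/
noncomputable def basicICell (I : Type u) [SmallCategory I] (n : ℕ) (i : I) :
    morProd i (TopCat.diskBoundary.{u} n) ⟶ morProd i (TopCat.disk.{u} n) :=
  morProdMap i (TopCat.diskBoundaryInclusion n)

end Cells

/-- The structure of a (contravariant) `I`-CW-complex on an `I`-space `X`.
The `n`-skeleton `X_n` is `sk.obj (n + 1)`, so that `sk.obj 0` is `X_{-1} = ∅`. -/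
structure ICWComplex {I : Type u} [SmallCategory I] (X : ISpace I) where
  /-- The filtration `X_{-1} ⟶ X_0 ⟶ X_1 ⟶ ⋯`. -/
  sk : ℕ ⥤ ISpace I
  /-- The maps of the skeleta to `X`. -/
  incl : sk ⟶ (Functor.const ℕ).obj X
  /-- The skeleta are subspaces of `X`. -/
  isEmbedding : ∀ (n : ℕ) (i : I), IsEmbedding (((incl.app n).app (.op i)).hom.hom)
  /-- `X_{-1}` is empty. -/
  isEmpty : ∀ i : I, IsEmpty ((sk.obj 0).obj (.op i)).obj
  /-- `X` is the colimit of its skeleta. -/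
  isColimit : IsColimit (Cocone.mk X incl)
  /-- `X_n` is obtained from `X_{n-1}` by attaching `I`-`n`-cells: there is a pushout of
  `I`-spaces along a coproduct, over an index set `ι`, of inclusions
  `mor_I(?, i) × S^{n-1} ⟶ mor_I(?, i) × D^n`. -/
  attachCells : ∀ n : ℕ,
    AttachCells.{u} (basicICell I n) (sk.map (homOfLE (Nat.le_succ n)))

/-- An `I`-CW-complex is finite if it is finite dimensional (`X = X_n` for some `n`)
and has only finitely many `I`-`n`-cells for every `n`. -/
structure ICWComplex.IsFinite {I : Type u} [SmallCategory I] {X : ISpace I}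
    (c : ICWComplex X) : Prop where
  finiteDimensional : ∃ n : ℕ, IsIso (c.incl.app n)
  finite_cells : ∀ n : ℕ, Finite (c.attachCells n).ι

/-- An `I`-CW-complex `X` is a model for the classifying `I`-space if `X(i)` is contractible
for every object `i`. -/
def ICWComplex.IsClassifyingModel {I : Type u} [SmallCategory I] {X : ISpace I}
    (_c : ICWComplex X) : Prop :=
  ∀ i : I, ContractibleSpace (X.obj (.op i)).obj

/-!
The model is a geometric realization of the nerve of the categories `j ↓ I` of objects under `j`,
with the redundant simplices removed. In a scwol two objects with morphisms in both directions are
isomorphic, so a set `S` of representatives of the isomorphism classes is partially ordered by the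
existence of morphisms (`exists_isAntisymmSet`). Let `X(j)` be the union of the simplices
`j ⟶ i₀ ⟶ ⋯ ⟶ iₚ`, where `i₀ ⟶ ⋯ ⟶ iₚ` is a chain of morphisms between distinct objects of `S`.
There are finitely many such chains, and `I` acts by precomposition with `j ⟶ i₀` alone, so that
each chain contributes exactly one cell `mor(?, i₀) × Dᵖ`.

To have `X(j)` as a compact Hausdorff space from the start, it is defined as a subset of a
finite-dimensional vector space: `chainPoint` records the barycentric coordinates `tₖ` at the
vertices `j ⟶ iₖ`, and the products `tₖ tₗ` at the morphisms `iₖ ⟶ iₗ`. The latter are independent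
of `j`, and they allow the chain to be recovered from any point of its open simplex, even when `I` has
parallel morphisms (`le_of_chainPoint_eq`, `chain_eq_of_chainPoint_eq`, `eq_of_chainPoint_eq`).
Thus the points outside the smaller skeleton are exactly those of the open top-dimensional
simplices, and the square attaching the cells is a pushout of sets; since all spaces in it are compact
Hausdorff, it is a pushout of spaces (`Spaces.isPushout_of_compactSpace`).

If `j` belongs to `S`, then `𝟙 j` is a vertex of `X(j)` and every simplex of `X(j)` lies in a
simplex containing that vertex, so that `X(j)` is contracted along straight lines
(`contractibleSpace_chainSkeleton`). In general `X(j)` is homeomorphic to `X(i)` for the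
representative `i` of `j`.
-/

/-! ### Colimits of compactly generated spaces -/

theorem Spaces.hom_ext {X Y : Spaces.{u}} {f g : X ⟶ Y} (h : ∀ x, f.hom x = g.hom x) : f = g :=
  ObjectProperty.hom_ext _ (TopCat.hom_ext (ContinuousMap.ext h))

/-- A commutative square of compactly generated spaces which is a pushout on underlying sets is a
pushout of spaces as soon as the two spaces being glued are compact: the map from their disjoint
union to the (Hausdorff) corner is then closed, hence a quotient map. -/
theorem Spaces.isPushout_of_compactSpace {A X B Z : Spaces.{u}} {t : A ⟶ X} {l : A ⟶ B}
    {r : X ⟶ Z} {b : B ⟶ Z} [CompactSpace X.obj] [CompactSpace B.obj]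
    (w : t ≫ r = l ≫ b) (hr : Function.Injective r.hom)
    (hsurj : ∀ z, (∃ x, r.hom x = z) ∨ ∃ y, b.hom y = z)
    (hrb : ∀ x y, r.hom x = b.hom y → ∃ a, t.hom a = x ∧ l.hom a = y)
    (hb : ∀ y y', b.hom y = b.hom y' → y = y' ∨ y ∈ Set.range l.hom) :
    IsPushout t l r b := by
  have : T2Space Z.obj := Z.property.1
  let q : C(X.obj ⊕ B.obj, Z.obj) := ⟨Sum.elim r.hom b.hom, by fun_prop⟩
  have hq : IsQuotientMap q := q.continuous.isClosedMap.isQuotientMap q.continuous (fun z => by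
    rcases hsurj z with ⟨x, hx⟩ | ⟨y, hy⟩
    exacts [⟨.inl x, hx⟩, ⟨.inr y, hy⟩])
  let g (s : PushoutCocone t l) : C(X.obj ⊕ B.obj, s.pt.obj) :=
    ⟨Sum.elim s.inl.hom s.inr.hom, by fun_prop⟩
  have hg (s : PushoutCocone t l) : Function.FactorsThrough (g s) q := by
    have hs : ∀ a, s.inl.hom (t.hom a) = s.inr.hom (l.hom a) := fun a =>
      ConcreteCategory.congr_hom (congrArg (·.hom) s.condition) a
    have ht : ∀ a, r.hom (t.hom a) = b.hom (l.hom a) := fun a =>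
      ConcreteCategory.congr_hom (congrArg (·.hom) w) a
    have key : ∀ x y, r.hom x = b.hom y → s.inl.hom x = s.inr.hom y := by
      intro x y h
      obtain ⟨a, rfl, rfl⟩ := hrb x y h
      exact hs a
    rintro (x | y) (x' | y') h
    · exact congrArg s.inl.hom (hr h)
    · exact key _ _ h
    · exact (key _ _ h.symm).symm
    · rcases hb y y' h with rfl | ⟨a, rfl⟩
      · rfl
      · exact (hs a).symm.trans (key _ _ ((ht a).trans h))
  refine ⟨⟨w⟩, ⟨PushoutCocone.IsColimit.mk w
    (fun s => ObjectProperty.homMk (TopCat.ofHom (hq.lift (g s) (hg s)))) ?_ ?_ ?_⟩⟩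
  · intro s
    ext x
    exact DFunLike.congr_fun (hq.lift_comp (g s) (hg s)) (Sum.inl x)
  · intro s
    ext y
    exact DFunLike.congr_fun (hq.lift_comp (g s) (hg s)) (Sum.inr y)
  · intro s m h₁ h₂
    ext z
    obtain ⟨x | y, rfl⟩ := hq.surjective z
    · exact (ConcreteCategory.congr_hom (congrArg (·.hom) h₁) x).trans
        (DFunLike.congr_fun (hq.lift_comp (g s) (hg s)) (Sum.inl x)).symm
    · exact (ConcreteCategory.congr_hom (congrArg (·.hom) h₂) y).trans
        (DFunLike.congr_fun (hq.lift_comp (g s) (hg s)) (Sum.inr y)).symm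

section Coproducts

variable {I : Type u} [SmallCategory I] {ι : Type u}

/-- The disjoint union of a family of `I`-spaces. -/
def sigmaISpace (A : ι → ISpace I) : ISpace I where
  obj j := ⟨TopCat.of (Σ i, ((A i).obj j).obj), by
    have h₁ := fun i => ((A i).obj j).property.1
    have h₂ := fun i => ((A i).obj j).property.2
    exact ⟨inferInstanceAs (T2Space (Σ i, ((A i).obj j).obj)),
      inferInstanceAs (CompactlyGeneratedSpace (Σ i, ((A i).obj j).obj))⟩⟩
  map f := ObjectProperty.homMk (TopCat.ofHom
    ⟨Sigma.map id fun i => ((A i).map f).hom, by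
      exact Continuous.sigma_map fun i => ((A i).map f).hom.hom.continuous⟩)
  map_id j := by
    refine Spaces.hom_ext fun ⟨i, x⟩ => ?_
    exact congrArg (fun y => (⟨i, y⟩ : Σ i, ((A i).obj j).obj))
      (ConcreteCategory.congr_hom (congrArg (·.hom) ((A i).map_id j)) x)
  map_comp {j k l} f g := by
    refine Spaces.hom_ext fun ⟨i, x⟩ => ?_
    exact congrArg (fun y => (⟨i, y⟩ : Σ i, ((A i).obj l).obj))
      (ConcreteCategory.congr_hom (congrArg (·.hom) ((A i).map_comp f g)) x)

/-- The cofan exhibiting the disjoint union as a coproduct of `I`-spaces. -/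
def sigmaCofan (A : ι → ISpace I) : Cofan A :=
  Cofan.mk (sigmaISpace A) fun i =>
    { app j := ObjectProperty.homMk (TopCat.ofHom
        ⟨fun x => (⟨i, x⟩ : Σ i, ((A i).obj j).obj), by
          exact continuous_sigmaMk (σ := fun i => ((A i).obj j).obj)⟩)
      naturality _ _ _ := rfl }

/-- The map out of the disjoint union determined by a family of maps. -/
def sigmaDesc {A : ι → ISpace I} {Z : ISpace I} (φ : ∀ i, A i ⟶ Z) : sigmaISpace A ⟶ Z where
  app j := ObjectProperty.homMk (TopCat.ofHom
    ⟨fun x => ((φ x.1).app j).hom x.2, by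
      exact continuous_sigma fun i => ((φ i).app j).hom.hom.continuous⟩)
  naturality j k f := by
    ext ⟨i, x⟩
    exact ConcreteCategory.congr_hom (congrArg (·.hom) ((φ i).naturality f)) x

/-- The disjoint union is the coproduct of `I`-spaces. -/
def sigmaCofanIsColimit (A : ι → ISpace I) : IsColimit (sigmaCofan A) :=
  Cofan.IsColimit.mk _ (fun s => (sigmaDesc s.inj : sigmaISpace A ⟶ s.pt))
    (fun s i => by ext j x; rfl)
    (fun s m h => by
      ext j x
      obtain ⟨i, x⟩ := x
      exact ConcreteCategory.congr_hom
        (congrArg (fun ψ : A i ⟶ s.pt => (ψ.app j).hom) (h i)) x)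

end Coproducts

/-! ### Compact subspaces -/

/-- A compact Hausdorff space is a compactly generated Hausdorff space. -/
theorem isSteenrodSpace_of_compactSpace (K : Type u) [TopologicalSpace K] [CompactSpace K]
    [T2Space K] : isSteenrodSpace (TopCat.of K) :=
  ⟨inferInstanceAs (T2Space K), inferInstanceAs (CompactlyGeneratedSpace K)⟩

section CompactSubspaces

variable {I : Type u} [SmallCategory I]

/-- A subfunctor of a functor `U` to topological spaces all of whose values are compact
Hausdorff subspaces. -/
structure CompactSubfunctor (U : Iᵒᵖ ⥤ TopCat.{u}) where
  /-- The underlying subset of each value. -/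
  carrier : ∀ j, Set (U.obj j)
  isCompact : ∀ j, IsCompact (carrier j)
  t2Space : ∀ j, T2Space (carrier j)
  map_mem : ∀ {j k} (f : j ⟶ k) {x}, x ∈ carrier j → U.map f x ∈ carrier k

namespace CompactSubfunctor

variable {U : Iᵒᵖ ⥤ TopCat.{u}}

instance : Preorder (CompactSubfunctor U) := Preorder.lift carrier

/-- The `I`-space of a compact subfunctor. -/
def toISpace (A : CompactSubfunctor U) : ISpace I where
  obj j := ⟨TopCat.of (A.carrier j), by
    have := A.t2Space j
    have := isCompact_iff_compactSpace.mp (A.isCompact j)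
    exact isSteenrodSpace_of_compactSpace _⟩
  map f := ObjectProperty.homMk (TopCat.ofHom
    ⟨fun x => ⟨U.map f x.1, A.map_mem f x.2⟩, by
      exact Continuous.subtype_mk ((U.map f).hom.continuous.comp continuous_subtype_val) _⟩)
  map_id j := by
    refine Spaces.hom_ext fun x => ?_
    exact Subtype.ext (p := (· ∈ A.carrier j)) (ConcreteCategory.congr_hom (U.map_id j) x.1)
  map_comp {_ _ l} f g := by
    refine Spaces.hom_ext fun x => ?_
    exact Subtype.ext (p := (· ∈ A.carrier l)) (ConcreteCategory.congr_hom (U.map_comp f g) x.1)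

instance (A : CompactSubfunctor U) (j : Iᵒᵖ) : CompactSpace (A.toISpace.obj j).obj :=
  isCompact_iff_compactSpace.mp (A.isCompact j)

/-- Passing from compact subfunctors to `I`-spaces is functorial with respect to inclusions. -/
def toISpaceFunctor (U : Iᵒᵖ ⥤ TopCat.{u}) : CompactSubfunctor U ⥤ ISpace I where
  obj A := A.toISpace
  map {A B} h :=
    { app j := ObjectProperty.homMk (TopCat.ofHom
        ⟨Set.inclusion (leOfHom h j), by exact continuous_inclusion (leOfHom h j)⟩)
      naturality _ _ _ := rfl }
  map_id _ := rfl
  map_comp _ _ := rfl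

end CompactSubfunctor

end CompactSubspaces

/-! ### The disk as a simplex -/

/-- The `p`-disk maps to the standard `p`-simplex, injectively, with interior mapping onto the
open simplex and boundary sphere to the boundary. -/
theorem exists_disk_to_stdSimplex (p : ℕ) :
    ∃ c : Metric.closedBall (0 : EuclideanSpace ℝ (Fin p)) 1 → Fin (p + 1) → ℝ,
      Continuous c ∧ Function.Injective c ∧ (∀ y, c y ∈ stdSimplex ℝ (Fin (p + 1))) ∧
      (∀ y, y.1 ∈ Metric.sphere 0 1 ↔ ∃ k, c y k = 0) ∧
      ∀ t ∈ stdSimplex ℝ (Fin (p + 1)), (∀ k, 0 < t k) → ∃ y, c y = t := by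
  -- the open simplex, after discarding the coordinate of index `0`
  let s : Set (EuclideanSpace ℝ (Fin p)) := {x | (∀ i, 0 < x i) ∧ ∑ i, x i < 1}
  let s' : Set (EuclideanSpace ℝ (Fin p)) := {x | (∀ i, 0 ≤ x i) ∧ ∑ i, x i ≤ 1}
  have hcoord (i : Fin p) : Continuous fun x : EuclideanSpace ℝ (Fin p) => x i := by fun_prop
  have hsum : Continuous fun x : EuclideanSpace ℝ (Fin p) => ∑ i, x i := by fun_prop
  have hso : IsOpen s := by
    have : s = (⋂ i, {x | 0 < x i}) ∩ {x | ∑ i, x i < 1} := by ext; simp [s]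
    rw [this]
    exact (isOpen_iInter_of_finite fun i => isOpen_lt continuous_const (hcoord i)).inter
      (isOpen_lt hsum continuous_const)
  have hs'c : IsClosed s' := by
    have : s' = (⋂ i, {x | 0 ≤ x i}) ∩ {x | ∑ i, x i ≤ 1} := by ext; simp [s']
    rw [this]
    exact (isClosed_iInter fun i => isClosed_le continuous_const (hcoord i)).inter
      (isClosed_le hsum continuous_const)
  have hss' : closure s ⊆ s' :=
    closure_minimal (fun x hx => ⟨fun i => (hx.1 i).le, hx.2.le⟩) hs'c
  have hconv : Convex ℝ s := by
    intro x hx y hy a b ha hb hab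
    have hpos : ∀ u v : ℝ, 0 < u → 0 < v → 0 < a * u + b * v := by
      intro u v hu hv
      rcases ha.eq_or_lt with rfl | ha
      · have : b = 1 := by linarith
        simpa [this] using hv
      · positivity
    refine ⟨fun i => ?_, ?_⟩
    · simpa using hpos _ _ (hx.1 i) (hy.1 i)
    · have := hpos _ _ (sub_pos.mpr hx.2) (sub_pos.mpr hy.2)
      simp only [PiLp.add_apply, PiLp.smul_apply, smul_eq_mul, Finset.sum_add_distrib,
        ← Finset.mul_sum]
      linarith
  have hne : (interior s).Nonempty := by
    rw [hso.interior_eq]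
    refine ⟨WithLp.toLp 2 fun _ => 1 / ((p : ℝ) + 1), fun i => ?_, ?_⟩
    · change 0 < 1 / ((p : ℝ) + 1)
      positivity
    · have hp : (0 : ℝ) < p + 1 := by positivity
      simp only [Finset.sum_const, Finset.card_univ, Fintype.card_fin, nsmul_eq_mul, mul_one_div]
      rw [div_lt_one hp]
      linarith
  have hbd : Bornology.IsBounded s := by
    refine (((isCompact_Icc (a := (0 : Fin p → ℝ)) (b := 1)).image
      (PiLp.continuous_toLp 2 fun _ : Fin p => ℝ)).isBounded).subset ?_
    intro x hx
    refine ⟨x.ofLp, ⟨fun i => (hx.1 i).le, fun i => ?_⟩, rfl⟩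
    exact (Finset.single_le_sum (f := fun i => x i) (fun i _ => (hx.1 i).le)
      (Finset.mem_univ i)).trans hx.2.le
  obtain ⟨h, hint, hcl, hfr⟩ :=
    exists_homeomorph_image_interior_closure_frontier_eq_unitBall hconv hne hbd
  rw [hso.interior_eq] at hint
  let c (y : EuclideanSpace ℝ (Fin p)) : Fin (p + 1) → ℝ :=
    Fin.cons (1 - ∑ i, h.symm y i) fun i => h.symm y i
  have hmem : ∀ y ∈ Metric.closedBall (0 : EuclideanSpace ℝ (Fin p)) 1, h.symm y ∈ s' := by
    intro y hy
    rw [← hcl] at hy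
    obtain ⟨x, hx, rfl⟩ := hy
    rw [h.symm_apply_apply]
    exact hss' hx
  have hball : ∀ y, y ∈ Metric.ball (0 : EuclideanSpace ℝ (Fin p)) 1 ↔ h.symm y ∈ s := by
    intro y
    rw [← hint]
    exact ⟨by rintro ⟨x, hx, rfl⟩; simpa using hx, fun hy => ⟨_, hy, by simp⟩⟩
  refine ⟨fun y => c y, ?_, ?_, ?_, ?_, ?_⟩
  · refine continuous_pi fun k => ?_
    refine Fin.cases ?_ (fun i => ?_) k <;> simp only [c, Fin.cons_zero, Fin.cons_succ] <;> fun_prop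
  · intro y y' hyy
    refine Subtype.ext (h.symm.injective ?_)
    ext i
    simpa [c] using congrFun hyy i.succ
  · intro y
    have := hmem y y.2
    refine ⟨fun k => ?_, ?_⟩
    · refine Fin.cases ?_ (fun i => ?_) k
      · simpa [c] using this.2
      · simpa [c] using this.1 i
    · simp [c, Fin.sum_univ_succ]
  · rintro ⟨y, hy⟩
    have hy' := hmem y hy
    have h₁ : y ∈ Metric.sphere (0 : EuclideanSpace ℝ (Fin p)) 1 ↔ h.symm y ∉ s := by
      rw [← hball]
      simp only [Metric.mem_closedBall, Metric.mem_sphere, Metric.mem_ball, not_lt] at hy ⊢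
      exact ⟨fun h => h.ge, fun h => le_antisymm hy h⟩
    rw [h₁, Fin.exists_fin_succ]
    simp only [c, Fin.cons_zero, Fin.cons_succ, s, Set.mem_ofPred_eq, not_and_or, not_forall,
      not_lt]
    constructor
    · rintro (⟨i, hi⟩ | hi)
      · exact .inr ⟨i, le_antisymm hi (hy'.1 i)⟩
      · exact .inl (by linarith [hy'.2])
    · rintro (hi | ⟨i, hi⟩)
      · exact .inr (by linarith)
      · exact .inl ⟨i, hi.le⟩
  · intro t ht hpos
    have hsum : ∑ i : Fin p, t i.succ = 1 - t 0 := by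
      have := ht.2
      rw [Fin.sum_univ_succ] at this
      linarith
    let x : EuclideanSpace ℝ (Fin p) := WithLp.toLp 2 fun i : Fin p => t i.succ
    have hx : x ∈ s := ⟨fun i => hpos _, by
      change ∑ i : Fin p, t i.succ < 1
      linarith [hpos 0]⟩
    have hy : h x ∈ Metric.ball (0 : EuclideanSpace ℝ (Fin p)) 1 := by
      rw [hball, h.symm_apply_apply]
      exact hx
    refine ⟨⟨h x, Metric.ball_subset_closedBall hy⟩, funext fun k => ?_⟩
    refine Fin.cases ?_ (fun i => ?_) k
    · simp [c, x, hsum]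
    · simp [c, x]

/-! ### Chains of morphisms and their simplices -/

section Chains

variable {I : Type u} [SmallCategory I]

/-- A chain `F : Fin (p + 1) ⥤ I` is simple in a set `S` of objects if its objects are pairwise
distinct and belong to `S`. -/
structure IsSimpleChain (S : Set I) {p : ℕ} (F : Fin (p + 1) ⥤ I) : Prop where
  injective : Function.Injective F.obj
  mem : ∀ k, F.obj k ∈ S

/-- The object `j ⟶ F 0 ⟶ F k` under `j` determined by a chain `F` and a morphism `j ⟶ F 0`. -/
def chainVertex {p : ℕ} (F : Fin (p + 1) ⥤ I) {j : I} (α : j ⟶ F.obj 0) (k : Fin (p + 1)) :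
    Σ i, j ⟶ i :=
  ⟨F.obj k, α ≫ F.map (homOfLE (Fin.zero_le k))⟩

/-- The morphism `F k ⟶ F l` of a chain `F`, together with its source and target. -/
def chainEdge {p : ℕ} (F : Fin (p + 1) ⥤ I) {k l : Fin (p + 1)} (h : k ≤ l) : Σ a b : I, a ⟶ b :=
  ⟨F.obj k, F.obj l, F.map (homOfLE h)⟩

theorem chainVertex_injective {p : ℕ} {F : Fin (p + 1) ⥤ I} (hF : Function.Injective F.obj)
    {j : I} (α : j ⟶ F.obj 0) : Function.Injective (chainVertex F α) :=
  fun _ _ h => hF (congrArg Sigma.fst h)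

/-- The face of a chain opposite to the vertex of index `k`. -/
abbrev chainFace {p : ℕ} (F : Fin (p + 2) ⥤ I) (k : Fin (p + 2)) : Fin (p + 1) ⥤ I :=
  (Fin.strictMono_succAbove k).monotone.functor ⋙ F

theorem IsSimpleChain.face {S : Set I} {p : ℕ} {F : Fin (p + 2) ⥤ I} (hF : IsSimpleChain S F)
    (k : Fin (p + 2)) : IsSimpleChain S (chainFace F k) :=
  ⟨hF.injective.comp Fin.succAbove_right_injective, fun _ => hF.mem _⟩

theorem functor_ext_of_chainEdge {p : ℕ} {F G : Fin (p + 1) ⥤ I}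
    (h₁ : ∀ k, F.obj k = G.obj k)
    (h₂ : ∀ k l (h : k < l), chainEdge F h.le = chainEdge G h.le) : F = G := by
  refine CategoryTheory.Functor.hext h₁ fun k l f => ?_
  rcases (leOfHom f).eq_or_lt with rfl | h
  · obtain rfl : f = 𝟙 k := Subsingleton.elim _ _
    rw [F.map_id, G.map_id, h₁]
  · have e := h₂ k l h
    simp only [chainEdge, Sigma.mk.injEq] at e
    obtain ⟨-, e⟩ := e
    have := h₁ k
    have h₁l := h₁ l
    obtain rfl : f = homOfLE h.le := Subsingleton.elim _ _
    revert e
    generalize F.map (homOfLE h.le) = u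
    generalize G.map (homOfLE h.le) = v
    generalize F.obj k = a at *
    generalize F.obj l = b at *
    subst this h₁l
    intro e
    simpa using e

instance [FinCategory I] (p : ℕ) : Finite (Fin (p + 1) ⥤ I) := by
  refine Finite.of_injective (β := Fin (p + 1) → Fin (p + 1) → Option (Σ a b : I, a ⟶ b))
    (fun F k l => if h : k ≤ l then some (chainEdge F h) else none) fun F G h => ?_
  have key : ∀ k l (h : k ≤ l), chainEdge F h = chainEdge G h := by
    intro k l hkl
    simpa [hkl] using congrFun (congrFun h k) l
  exact functor_ext_of_chainEdge (fun k => congrArg Sigma.fst (key k k le_rfl))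
    fun k l h => key k l h.le

/-- The ambient vector space for the simplices over `j`: one coordinate for every object of the
category under `j`, and one for every morphism of `I`. -/
abbrev ChainSpace (j : I) : Type u := ((Σ i, j ⟶ i) → ℝ) × ((Σ a b : I, a ⟶ b) → ℝ)

variable (I) [FinCategory I] in
/-- A morphism `j ⟶ k` of `I` acts on the vertex coordinates by push-forward along the functor from
objects under `k` to objects under `j`, and trivially on the edge coordinates. -/
noncomputable def chainSpaceFunctor : Iᵒᵖ ⥤ TopCat.{u} where
  obj j := TopCat.of (ChainSpace j.unop)
  map {j k} f := TopCat.ofHom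
    ⟨Prod.map (FunOnFinite.linearMap ℝ ℝ
      fun v : Σ i, j.unop ⟶ i => (⟨v.1, f.unop ≫ v.2⟩ : Σ i, k.unop ⟶ i)) id,
      ((FunOnFinite.continuous_linearMap ℝ ℝ _).prodMap continuous_id)⟩
  map_id j := by
    have h : (fun v : Σ i, j.unop ⟶ i => (⟨v.1, (𝟙 j : j ⟶ j).unop ≫ v.2⟩ : Σ i, j.unop ⟶ i)) =
        id := funext fun v => congrArg (Sigma.mk v.1) (Category.id_comp v.2)
    refine TopCat.hom_ext (ContinuousMap.ext fun x => Prod.ext ?_ rfl)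
    change FunOnFinite.linearMap ℝ ℝ
      (fun v : Σ i, j.unop ⟶ i => (⟨v.1, (𝟙 j : j ⟶ j).unop ≫ v.2⟩ : Σ i, j.unop ⟶ i)) x.1 = x.1
    rw [h, FunOnFinite.linearMap_id]
    rfl
  map_comp {j k l} f g := by
    have h : (fun v : Σ i, j.unop ⟶ i => (⟨v.1, (f ≫ g).unop ≫ v.2⟩ : Σ i, l.unop ⟶ i)) =
        (fun v : Σ i, k.unop ⟶ i => (⟨v.1, g.unop ≫ v.2⟩ : Σ i, l.unop ⟶ i)) ∘
          fun v : Σ i, j.unop ⟶ i => (⟨v.1, f.unop ≫ v.2⟩ : Σ i, k.unop ⟶ i) :=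
      funext fun v => congrArg (Sigma.mk v.1) (Category.assoc g.unop f.unop v.2)
    refine TopCat.hom_ext (ContinuousMap.ext fun x => Prod.ext ?_ rfl)
    change FunOnFinite.linearMap ℝ ℝ
      (fun v : Σ i, j.unop ⟶ i => (⟨v.1, (f ≫ g).unop ≫ v.2⟩ : Σ i, l.unop ⟶ i)) x.1 = _
    rw [h, FunOnFinite.linearMap_comp]
    rfl

open Classical in
/-- The point with barycentric coordinates `t` in the simplex over `j` determined by a chain `F`
and a morphism `α : j ⟶ F 0`. Its vertex coordinates are the `t k`, its edge coordinates the
products `t k * t l`; the latter record which of several parallel morphisms the chain uses. -/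
noncomputable def chainPoint {p : ℕ} (F : Fin (p + 1) ⥤ I) {j : I} (α : j ⟶ F.obj 0)
    (t : Fin (p + 1) → ℝ) : ChainSpace j :=
  (∑ k, Pi.single (chainVertex F α k) (t k),
    ∑ k, ∑ l, if h : k < l then Pi.single (chainEdge F h.le) (t k * t l) else 0)

@[fun_prop]
theorem continuous_chainPoint {p : ℕ} (F : Fin (p + 1) ⥤ I) {j : I} (α : j ⟶ F.obj 0) :
    Continuous (chainPoint F α) := by
  classical
  refine Continuous.prodMk ?_ ?_
  · refine continuous_finsetSum _ fun k _ => ?_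
    exact (continuous_single _).comp (continuous_apply k)
  · refine continuous_finsetSum _ fun k _ => continuous_finsetSum _ fun l _ => ?_
    split_ifs
    · exact (continuous_single _).comp ((continuous_apply k).mul (continuous_apply l))
    · exact continuous_const

theorem chainSpaceFunctor_map_chainPoint [FinCategory I] {p : ℕ}
    (F : Fin (p + 1) ⥤ I) {j k : I} (f : j ⟶ k) (α : k ⟶ F.obj 0) (t : Fin (p + 1) → ℝ) :
    (chainSpaceFunctor I).map f.op (chainPoint F α t) = chainPoint F (f ≫ α) t := by
  classical
  refine Prod.ext ?_ rfl
  change FunOnFinite.linearMap ℝ ℝ _ (chainPoint F α t).1 = _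
  simp [chainPoint, chainVertex, FunOnFinite.linearMap_piSingle]

/-- A simplex restricts to its faces. -/
theorem chainPoint_face {p : ℕ} (F : Fin (p + 2) ⥤ I) {j : I} (α : j ⟶ F.obj 0)
    (t : Fin (p + 2) → ℝ) {k : Fin (p + 2)} (hk : t k = 0) :
    chainPoint (chainFace F k) (α ≫ F.map (homOfLE (Fin.zero_le (k.succAbove 0))))
      (t ∘ k.succAbove) = chainPoint F α t := by
  classical
  refine Prod.ext ?_ ?_
  · have hv : ∀ l, chainVertex (chainFace F k)
        (α ≫ F.map (homOfLE (Fin.zero_le (k.succAbove 0)))) l =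
        chainVertex F α (k.succAbove l) := by
      intro l
      refine congrArg (Sigma.mk (F.obj (k.succAbove l))) ?_
      rw [Category.assoc, CategoryTheory.Functor.comp_map, ← F.map_comp]
      rfl
    simp only [chainPoint, Fin.sum_univ_succAbove _ k, hk, Pi.single_zero, zero_add, hv,
      Function.comp_apply]
  · simp only [chainPoint, Fin.sum_univ_succAbove _ k, hk, zero_mul, mul_zero, Pi.single_zero,
      dite_eq_ite, ite_self, Finset.sum_const_zero, zero_add, Function.comp_apply,
      Fin.succAbove_lt_succAbove_iff]
    rfl

variable {S : Set I} {p : ℕ} {F : Fin (p + 1) ⥤ I} {j : I}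

theorem chainPoint_fst_chainVertex (hF : Function.Injective F.obj) (α : j ⟶ F.obj 0)
    (t : Fin (p + 1) → ℝ) (k : Fin (p + 1)) :
    (chainPoint F α t).1 (chainVertex F α k) = t k := by
  classical
  dsimp only [chainPoint]
  rw [Finset.sum_apply, Finset.sum_eq_single k]
  · simp
  · intro l _ hl
    exact Pi.single_eq_of_ne (fun h => hl (chainVertex_injective hF α h).symm) _
  · simp

theorem exists_of_chainPoint_fst_ne_zero {α : j ⟶ F.obj 0} {t : Fin (p + 1) → ℝ} {v : Σ i, j ⟶ i}
    (h : (chainPoint F α t).1 v ≠ 0) : ∃ k, v = chainVertex F α k := by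
  classical
  dsimp only [chainPoint] at h
  rw [Finset.sum_apply] at h
  obtain ⟨k, -, hk⟩ := Finset.exists_ne_zero_of_sum_ne_zero h
  exact ⟨k, by_contra fun hv => hk (Pi.single_eq_of_ne hv _)⟩

theorem exists_of_chainPoint_snd_ne_zero {α : j ⟶ F.obj 0} {t : Fin (p + 1) → ℝ}
    {e : Σ a b : I, a ⟶ b} (h : (chainPoint F α t).2 e ≠ 0) :
    ∃ (k l : Fin (p + 1)) (h : k < l), e = chainEdge F h.le := by
  classical
  dsimp only [chainPoint] at h
  rw [Finset.sum_apply] at h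
  obtain ⟨k, -, hk⟩ := Finset.exists_ne_zero_of_sum_ne_zero h
  rw [Finset.sum_apply] at hk
  obtain ⟨l, -, hl⟩ := Finset.exists_ne_zero_of_sum_ne_zero hk
  split_ifs at hl with hkl
  · exact ⟨k, l, hkl, by_contra fun hv => hl (Pi.single_eq_of_ne hv _)⟩
  · exact absurd rfl hl

theorem chainPoint_snd_chainEdge_pos (α : j ⟶ F.obj 0) {t : Fin (p + 1) → ℝ} (ht : ∀ k, 0 < t k)
    {k l : Fin (p + 1)} (h : k < l) : 0 < (chainPoint F α t).2 (chainEdge F h.le) := by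
  classical
  have hnn : ∀ k' l', 0 ≤ (if h : k' < l' then
      Pi.single (M := fun _ => ℝ) (chainEdge F h.le) (t k' * t l') else 0) (chainEdge F h.le) := by
    intro k' l'
    split_ifs
    · rw [Pi.single_apply]
      have := mul_pos (ht k') (ht l')
      split_ifs <;> positivity
    · exact le_rfl
  dsimp only [chainPoint]
  rw [Finset.sum_apply]
  refine Finset.sum_pos' (fun k' _ => ?_) ⟨k, Finset.mem_univ _, ?_⟩
  · rw [Finset.sum_apply]
    exact Finset.sum_nonneg fun l' _ => hnn k' l'
  · rw [Finset.sum_apply]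
    refine Finset.sum_pos' (fun l' _ => hnn k l') ⟨l, Finset.mem_univ _, ?_⟩
    rw [dif_pos h, Pi.single_eq_same]
    exact mul_pos (ht k) (ht l)

/-- The dimension of the open simplex containing a point is determined by the point. -/
theorem le_of_chainPoint_eq (hF : Function.Injective F.obj) {α : j ⟶ F.obj 0}
    {t : Fin (p + 1) → ℝ} (ht : ∀ k, 0 < t k) {q : ℕ} {G : Fin (q + 1) ⥤ I} {β : j ⟶ G.obj 0}
    {s : Fin (q + 1) → ℝ} (h : chainPoint F α t = chainPoint G β s) : p ≤ q := by
  have : ∀ k, ∃ k', chainVertex F α k = chainVertex G β k' := fun k =>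
    exists_of_chainPoint_fst_ne_zero (t := s)
      (by rw [← h, chainPoint_fst_chainVertex hF]; exact (ht k).ne')
  choose π hπ using this
  have hinj : Function.Injective π := fun a b hab =>
    chainVertex_injective hF α (by rw [hπ, hπ, hab])
  simpa using Fintype.card_le_of_injective π hinj

/-- The chain of the open simplex containing a point is determined by the point. -/
theorem chain_eq_of_chainPoint_eq (hF : Function.Injective F.obj) {G : Fin (p + 1) ⥤ I}
    (hG : Function.Injective G.obj) {α : j ⟶ F.obj 0} {β : j ⟶ G.obj 0} {t s : Fin (p + 1) → ℝ}
    (ht : ∀ k, 0 < t k) (h : chainPoint F α t = chainPoint G β s) : F = G := by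
  have : ∀ k, ∃ k', chainVertex F α k = chainVertex G β k' := fun k =>
    exists_of_chainPoint_fst_ne_zero (t := s)
      (by rw [← h, chainPoint_fst_chainVertex hF]; exact (ht k).ne')
  choose π hπ using this
  have hπo : ∀ k, F.obj k = G.obj (π k) := fun k => congrArg Sigma.fst (hπ k)
  have hedge : ∀ k l (h : k < l), ∃ h' : π k < π l, chainEdge F h.le = chainEdge G h'.le := by
    intro k l hkl
    obtain ⟨k', l', hkl', e⟩ := exists_of_chainPoint_snd_ne_zero (t := s) (α := β)
      (e := chainEdge F hkl.le) (by rw [← h]; exact (chainPoint_snd_chainEdge_pos α ht hkl).ne')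
    obtain rfl : π k = k' := hG ((hπo k).symm.trans (congrArg Sigma.fst e))
    obtain rfl : π l = l' := hG ((hπo l).symm.trans (congrArg (fun e => e.2.1) e))
    exact ⟨hkl', e⟩
  have hmono : StrictMono π := fun k l hkl => (hedge k l hkl).1
  -- the objects of both chains are linearly ordered by the existence of edges
  have hπid : π = id := by
    refine (hmono.range_inj strictMono_id).mp ?_
    rw [(Finite.injective_iff_surjective.mp hmono.injective).range_eq, Set.range_id]
  subst hπid
  exact functor_ext_of_chainEdge hπo fun k l hkl => (hedge k l hkl).2

/-- The coordinates of a point in an open simplex are determined by the point. -/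
theorem eq_of_chainPoint_eq (hF : Function.Injective F.obj) {α β : j ⟶ F.obj 0}
    {t s : Fin (p + 1) → ℝ} (ht : ∀ k, 0 < t k) (h : chainPoint F α t = chainPoint F β s) :
    α = β ∧ t = s := by
  obtain rfl : α = β := by
    obtain ⟨k, hk⟩ := exists_of_chainPoint_fst_ne_zero (α := β) (t := s) (v := chainVertex F α 0)
      (by rw [← h, chainPoint_fst_chainVertex hF]; exact (ht 0).ne')
    obtain rfl : 0 = k := hF (congrArg Sigma.fst hk)
    have := eq_of_heq (Sigma.mk.inj hk).2
    simpa [Subsingleton.elim (homOfLE (Fin.zero_le (0 : Fin (p + 1)))) (𝟙 0)] using this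
  exact ⟨rfl, funext fun k => by
    rw [← chainPoint_fst_chainVertex hF α t, h, chainPoint_fst_chainVertex hF]⟩

end Chains

/-! ### Skeleta of the classifying space -/

section Skeleta

variable {I : Type u} [SmallCategory I]

/-- The union of the simplices over `j` of dimension less than `n` that belong to simple chains in
`S`. -/
def chainSkeleton (S : Set I) (n : ℕ) (j : I) : Set (ChainSpace j) :=
  {x | ∃ p < n, ∃ F : Fin (p + 1) ⥤ I, IsSimpleChain S F ∧ ∃ α : j ⟶ F.obj 0,
    ∃ t ∈ stdSimplex ℝ (Fin (p + 1)), chainPoint F α t = x}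

theorem chainSkeleton_mono (S : Set I) (j : I) : Monotone fun n => chainSkeleton S n j :=
  fun _ _ h _ ⟨p, hp, hx⟩ => ⟨p, hp.trans_le h, hx⟩

theorem isCompact_chainSkeleton [FinCategory I] (S : Set I) (n : ℕ) (j : I) :
    IsCompact (chainSkeleton S n j) := by
  have : chainSkeleton S n j = ⋃ p ∈ Set.Iio n, ⋃ F : {F : Fin (p + 1) ⥤ I // IsSimpleChain S F},
      ⋃ α : j ⟶ F.1.obj 0, chainPoint F.1 α '' stdSimplex ℝ (Fin (p + 1)) := by
    ext x
    simp [chainSkeleton]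
  rw [this]
  refine (Set.finite_Iio n).isCompact_biUnion fun p _ => isCompact_iUnion fun F =>
    isCompact_iUnion fun α => ?_
  exact (isCompact_stdSimplex ℝ (Fin (p + 1))).image (continuous_chainPoint _ _)

/-- The chain `j ⟶ F 0 ⟶ F 1 ⟶ ⋯` obtained from a chain `F` and a morphism `j ⟶ F 0`. -/
def chainCons {p : ℕ} (F : Fin (p + 1) ⥤ I) {j : I} (α : j ⟶ F.obj 0) : Fin (p + 2) ⥤ I :=
  ComposableArrows.precomp (n := p) F α

/-- The identity of `j`, as a morphism to the initial object of `chainCons F α`. -/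
def chainConsHom {p : ℕ} (F : Fin (p + 1) ⥤ I) {j : I} (α : j ⟶ F.obj 0) :
    j ⟶ (chainCons F α).obj 0 :=
  𝟙 j

/-- This is where finiteness of the complex comes from: a simple chain visits each object at most
once. -/
theorem lt_card_of_isSimpleChain [Fintype I] {S : Set I} {p : ℕ} {F : Fin (p + 1) ⥤ I}
    (hF : IsSimpleChain S F) : p < Fintype.card I := by
  have := Fintype.card_le_of_injective _ hF.injective
  rwa [Fintype.card_fin] at this

theorem chainSkeleton_subset_card [Fintype I] (S : Set I) (n : ℕ) (j : I) :
    chainSkeleton S n j ⊆ chainSkeleton S (Fintype.card I) j :=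
  fun _ ⟨p, _, F, hF, hx⟩ => ⟨p, lt_card_of_isSimpleChain hF, F, hF, hx⟩

/-- The skeleta as compact subfunctors of the ambient vector spaces. -/
noncomputable def chainSubfunctor [FinCategory I] (S : Set I) (n : ℕ) :
    CompactSubfunctor (chainSpaceFunctor I) where
  carrier j := chainSkeleton S n j.unop
  isCompact j := isCompact_chainSkeleton S n j.unop
  t2Space j := inferInstanceAs (T2Space (chainSkeleton S n j.unop))
  map_mem {j k} f x hx := by
    obtain ⟨p, hp, F, hF, α, t, ht, rfl⟩ := hx
    exact ⟨p, hp, F, hF, f.unop ≫ α, t, ht, (chainSpaceFunctor_map_chainPoint F f.unop α t).symm⟩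

theorem chainSubfunctor_mono [FinCategory I] (S : Set I) :
    Monotone (chainSubfunctor S : ℕ → CompactSubfunctor (chainSpaceFunctor I)) :=
  fun _ _ h j => chainSkeleton_mono S j.unop h

/-- A point with a vanishing barycentric coordinate lies in a lower skeleton. -/
theorem chainPoint_mem_of_eq_zero {S : Set I} {p : ℕ} {F : Fin (p + 1) ⥤ I}
    (hF : IsSimpleChain S F) {j : I} (α : j ⟶ F.obj 0) {t : Fin (p + 1) → ℝ}
    (ht : t ∈ stdSimplex ℝ (Fin (p + 1))) {k : Fin (p + 1)} (hk : t k = 0) :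
    chainPoint F α t ∈ chainSkeleton S p j := by
  cases p with
  | zero =>
    have := ht.2
    obtain rfl : k = 0 := Fin.fin_one_eq_zero k
    rw [Fin.sum_univ_one, hk] at this
    exact absurd this zero_ne_one
  | succ p =>
    refine ⟨p, p.lt_succ_self, _, hF.face k, _, _, ⟨fun l => ht.1 _, ?_⟩, chainPoint_face F α t hk⟩
    have := ht.2
    rwa [Fin.sum_univ_succAbove _ k, hk, zero_add] at this

end Skeleta

/-! ### Contractibility -/

section Contraction

variable {I : Type u} [SmallCategory I]

/-- A set of objects in which no two distinct objects have morphisms in both directions. -/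
def IsAntisymmSet (S : Set I) : Prop :=
  ∀ a ∈ S, ∀ b ∈ S, (a ⟶ b) → (b ⟶ a) → a = b

variable [FinCategory I]

open Classical in
/-- The linear map sending the vertex coordinate of `α : j ⟶ i` to the edge coordinate of `α`,
except that those with `i = j` are sent to zero. -/
noncomputable def vertexToEdge (j : I) : ((Σ i, j ⟶ i) → ℝ) →ₗ[ℝ] ((Σ a b : I, a ⟶ b) → ℝ) :=
  Fintype.linearCombination ℝ fun v => if v.1 = j then 0 else Pi.single ⟨j, v⟩ 1

open Classical in
/-- The straight-line contraction to the vertex `𝟙 j` at time `s`. In barycentric coordinates a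
point `t` moves to `(1 - s) • t + s • 𝟙 j`; the products of pairs of coordinates change
accordingly. -/
noncomputable def coneContraction (j : I) (s : ℝ) (x : ChainSpace j) : ChainSpace j :=
  ((1 - s) • x.1 + s • Pi.single ⟨j, 𝟙 j⟩ 1,
    (1 - s) ^ 2 • x.2 + (s * (1 - s)) • vertexToEdge j x.1)

theorem continuous_coneContraction (j : I) :
    Continuous fun y : ℝ × ChainSpace j => coneContraction j y.1 y.2 := by
  have : Continuous (vertexToEdge j) := LinearMap.continuous_of_finiteDimensional _
  unfold coneContraction
  fun_prop

theorem coneContraction_zero (j : I) (x : ChainSpace j) : coneContraction j 0 x = x := by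
  simp [coneContraction]

theorem coneContraction_one (j : I) (x y : ChainSpace j) :
    coneContraction j 1 x = coneContraction j 1 y := by
  simp [coneContraction]

open Classical in
theorem vertexToEdge_single_self {j : I} (α : j ⟶ j) (r : ℝ) :
    vertexToEdge j (Pi.single ⟨j, α⟩ r) = 0 := by
  simp [vertexToEdge, Fintype.linearCombination_apply_single]

open Classical in
theorem vertexToEdge_single_of_ne {j : I} {v : Σ i, j ⟶ i} (hv : v.1 ≠ j) (r : ℝ) :
    vertexToEdge j (Pi.single v r) = Pi.single ⟨j, v⟩ r := by
  rw [vertexToEdge, Fintype.linearCombination_apply_single, if_neg hv, ← Pi.single_smul,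
    smul_eq_mul, mul_one]

open Classical in
omit [FinCategory I] in
theorem chainPoint_fst_eq_add {p : ℕ} (F : Fin (p + 1) ⥤ I) {j : I} (α : j ⟶ F.obj 0)
    (t : Fin (p + 1) → ℝ) :
    (chainPoint F α t).1 =
      Pi.single ⟨F.obj 0, α⟩ (t 0) +
        ∑ l : Fin p, Pi.single (chainVertex F α l.succ) (t l.succ) := by
  have h : chainVertex F α 0 = ⟨F.obj 0, α⟩ := by
    refine congrArg (Sigma.mk _) ?_
    rw [Subsingleton.elim (homOfLE (Fin.zero_le (0 : Fin (p + 1)))) (𝟙 0)]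
    simp
  rw [← h]
  exact Fin.sum_univ_succ _

open Classical in
omit [FinCategory I] in
theorem chainPoint_snd_eq_add {p : ℕ} (F : Fin (p + 1) ⥤ I) {j : I} (α : j ⟶ F.obj 0)
    (t : Fin (p + 1) → ℝ) :
    (chainPoint F α t).2 =
      ∑ l : Fin p, Pi.single (chainEdge F (Fin.zero_le l.succ)) (t 0 * t l.succ) +
      ∑ k : Fin p, ∑ l : Fin p, if h : k < l then
        Pi.single (chainEdge F (Fin.succ_le_succ_iff.mpr h.le)) (t k.succ * t l.succ) else 0 := by
  simp [chainPoint, Fin.sum_univ_succ]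

/-- If a chain starts at `j`, the contraction stays within its simplex. -/
theorem coneContraction_chainPoint_of_eq {p : ℕ} {F : Fin (p + 1) ⥤ I}
    (hF : Function.Injective F.obj) (s : ℝ) (t : Fin (p + 1) → ℝ) :
    coneContraction (F.obj 0) s (chainPoint F (𝟙 _) t) =
      chainPoint F (𝟙 _) ((1 - s) • t + s • Pi.single 0 1) := by
  classical
  refine Prod.ext ?_ ?_
  · rw [coneContraction, chainPoint_fst_eq_add, chainPoint_fst_eq_add]
    simp only [smul_add, Finset.smul_sum, ← Pi.single_smul, Pi.add_apply, Pi.smul_apply,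
      Pi.single_eq_same, Pi.single_eq_of_ne (Fin.succ_ne_zero _), smul_eq_mul, add_zero,
      Pi.single_add, mul_one]
    abel
  · have hv (l : Fin p) (r : ℝ) : vertexToEdge (F.obj 0)
        (Pi.single (chainVertex F (𝟙 _) l.succ) r) =
        Pi.single (chainEdge F (Fin.zero_le l.succ)) r := by
      rw [vertexToEdge_single_of_ne fun h => Fin.succ_ne_zero l (hF h)]
      congr 1
      refine congrArg (fun f => (⟨_, _, f⟩ : Σ a b : I, a ⟶ b)) (Category.id_comp _)
    rw [coneContraction, chainPoint_fst_eq_add, chainPoint_snd_eq_add, chainPoint_snd_eq_add]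
    simp only [map_add, map_sum, vertexToEdge_single_self, hv, zero_add, smul_add,
      Finset.smul_sum, ← Pi.single_smul, Pi.add_apply, Pi.smul_apply,
      Pi.single_eq_same, Pi.single_eq_of_ne (Fin.succ_ne_zero _), smul_eq_mul, add_zero,
      mul_one, smul_dite, smul_zero]
    rw [add_right_comm, ← Finset.sum_add_distrib]
    simp only [← Pi.single_add]
    refine congrArg₂ (· + ·) (Finset.sum_congr rfl fun l _ => congrArg _ (by ring))
      (Finset.sum_congr rfl fun k _ => Finset.sum_congr rfl fun l _ => ?_)
    split_ifs
    · exact congrArg _ (by ring)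
    · rfl

omit [FinCategory I] in
theorem chainEdge_cons_zero {p : ℕ} (F : Fin (p + 1) ⥤ I) {j : I} (α : j ⟶ F.obj 0)
    (l : Fin (p + 1)) :
    chainEdge (chainCons F α) (Fin.zero_le l.succ) = ⟨j, chainVertex F α l⟩ := by
  refine congrArg (fun f => (⟨j, F.obj l, f⟩ : Σ a b : I, a ⟶ b)) ?_
  obtain ⟨_ | l, hl⟩ := l
  · change α = α ≫ F.map (𝟙 0)
    rw [F.map_id, Category.comp_id]
  · rfl

omit [FinCategory I] in
theorem chainVertex_cons_succ {p : ℕ} (F : Fin (p + 1) ⥤ I) {j : I} (α : j ⟶ F.obj 0)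
    (l : Fin (p + 1)) :
    chainVertex (chainCons F α) (chainConsHom F α) l.succ = chainVertex F α l := by
  have h := chainEdge_cons_zero F α l
  refine (congrArg (fun f => (⟨F.obj l, f⟩ : Σ i, j ⟶ i)) (Category.id_comp _)).trans ?_
  exact eq_of_heq (Sigma.mk.inj h).2

/-- If a chain does not meet `j`, the contraction takes place in the cone on its simplex. -/
theorem coneContraction_chainPoint_of_ne {p : ℕ} {F : Fin (p + 1) ⥤ I} {j : I}
    (hF : ∀ k, F.obj k ≠ j) (α : j ⟶ F.obj 0) (s : ℝ) (t : Fin (p + 1) → ℝ) :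
    coneContraction j s (chainPoint F α t) =
      chainPoint (chainCons F α) (chainConsHom F α) (Fin.cons s ((1 - s) • t)) := by
  classical
  have he (k l : Fin (p + 1)) (h : k.succ ≤ l.succ) :
      chainEdge (chainCons F α) h = chainEdge F (Fin.succ_le_succ_iff.mp h) := rfl
  refine Prod.ext ?_ ?_
  · rw [chainPoint_fst_eq_add]
    simp only [coneContraction, chainPoint, chainVertex_cons_succ, Fin.cons_zero, Fin.cons_succ,
      Pi.smul_apply, smul_eq_mul, Finset.smul_sum, ← Pi.single_smul, mul_one]
    rw [add_comm]
    rfl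
  · have hvE (l : Fin (p + 1)) (r : ℝ) : vertexToEdge j (Pi.single (chainVertex F α l) r) =
        Pi.single ⟨j, chainVertex F α l⟩ r := vertexToEdge_single_of_ne (hF l) r
    rw [chainPoint_snd_eq_add]
    simp only [coneContraction, chainPoint, chainEdge_cons_zero, he, Fin.cons_zero, Fin.cons_succ,
      Pi.smul_apply, smul_eq_mul, Finset.smul_sum, ← Pi.single_smul, mul_one, map_sum, hvE,
      smul_dite, smul_zero]
    rw [add_comm]
    refine congrArg₂ (· + ·) (Finset.sum_congr rfl fun l _ => congrArg _ (by ring))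
      (Finset.sum_congr rfl fun k _ => Finset.sum_congr rfl fun l _ => ?_)
    split_ifs
    · exact congrArg _ (by ring)
    · rfl

/-- Antisymmetry of `S` ensures that a chain over `j` starting elsewhere does not return to `j`, so
that its cone is again simple. -/
theorem coneContraction_mem [IsScwol I] {S : Set I} (hS : IsAntisymmSet S) {j : I} (hj : j ∈ S)
    {s : ℝ} (hs : s ∈ Set.Icc (0 : ℝ) 1) {x : ChainSpace j}
    (hx : x ∈ chainSkeleton S (Fintype.card I) j) :
    coneContraction j s x ∈ chainSkeleton S (Fintype.card I) j := by
  classical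
  obtain ⟨p, hp, F, hF, α, t, ht, rfl⟩ := hx
  have hs' : 0 ≤ 1 - s := sub_nonneg.mpr hs.2
  by_cases h : F.obj 0 = j
  · subst h
    obtain rfl : α = 𝟙 _ := IsScwol.endo_eq_id α
    rw [coneContraction_chainPoint_of_eq hF.injective]
    exact ⟨p, hp, F, hF, _, _, convex_stdSimplex ℝ _ ht (single_mem_stdSimplex ℝ 0) hs' hs.1
      (sub_add_cancel 1 s), rfl⟩
  · have hne : ∀ k, F.obj k ≠ j := fun k hk =>
      h (hS _ (hF.mem 0) _ hj (F.map (homOfLE (Fin.zero_le k)) ≫ eqToHom hk) α)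
    rw [coneContraction_chainPoint_of_ne hne]
    have hG : IsSimpleChain S (chainCons F α) := by
      refine ⟨fun k l hkl => ?_, fun k => ?_⟩
      · induction k using Fin.cases with
        | zero =>
          induction l using Fin.cases with
          | zero => rfl
          | succ l => exact absurd hkl.symm (hne l)
        | succ k =>
          induction l using Fin.cases with
          | zero => exact absurd hkl (hne k)
          | succ l => exact congrArg Fin.succ (hF.injective hkl)
      · induction k using Fin.cases with
        | zero => exact hj
        | succ k => exact hF.mem k
    refine ⟨p + 1, lt_card_of_isSimpleChain hG, _, hG, _, _, ⟨fun k => ?_, ?_⟩, rfl⟩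
    · induction k using Fin.cases with
      | zero => exact hs.1
      | succ k => exact mul_nonneg hs' (ht.1 k)
    · simp [Fin.sum_univ_succ, ← Finset.mul_sum, ht.2]

theorem contractibleSpace_chainSkeleton [IsScwol I] {S : Set I} (hS : IsAntisymmSet S) {j : I}
    (hj : j ∈ S) : ContractibleSpace (chainSkeleton S (Fintype.card I) j) := by
  rw [contractible_iff_id_nullhomotopic]
  -- the vertex `𝟙 j`
  let F₀ : Fin (0 + 1) ⥤ I := (Functor.const _).obj j
  have hx₀ : chainPoint F₀ (𝟙 j) (fun _ => 1) ∈ chainSkeleton S (Fintype.card I) j :=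
    chainSkeleton_subset_card S 1 j ⟨0, one_pos, F₀,
      ⟨fun k l _ => (Fin.fin_one_eq_zero k).trans (Fin.fin_one_eq_zero l).symm, fun _ => hj⟩,
      𝟙 j, _,
      ⟨fun _ => zero_le_one, by simp⟩, rfl⟩
  refine ⟨⟨_, coneContraction_mem hS hj (s := 1) (by simp) hx₀⟩, ⟨?_⟩⟩
  refine
    { toFun := fun y => ⟨_, coneContraction_mem hS hj y.1.2 y.2.2⟩
      continuous_toFun := ?_
      map_zero_left := fun x => Subtype.ext (coneContraction_zero j x)
      map_one_left := fun x => Subtype.ext (coneContraction_one j _ _) }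
  exact ((continuous_coneContraction j).comp (by fun_prop :
    Continuous fun y : unitInterval × chainSkeleton S (Fintype.card I) j =>
      ((y.1 : ℝ), (y.2 : ChainSpace j)))).subtype_mk _

end Contraction

/-! ### Attaching the cells -/

section AttachingCells

/-- A choice of map from the `p`-disk to the standard `p`-simplex which identifies interiors. -/
noncomputable def diskToSimplex (p : ℕ) :
    Metric.closedBall (0 : EuclideanSpace ℝ (Fin p)) 1 → Fin (p + 1) → ℝ :=
  (exists_disk_to_stdSimplex p).choose

theorem continuous_diskToSimplex (p : ℕ) : Continuous (diskToSimplex p) :=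
  (exists_disk_to_stdSimplex p).choose_spec.1

theorem diskToSimplex_injective (p : ℕ) : Function.Injective (diskToSimplex p) :=
  (exists_disk_to_stdSimplex p).choose_spec.2.1

theorem diskToSimplex_mem {p : ℕ} (y : Metric.closedBall (0 : EuclideanSpace ℝ (Fin p)) 1) :
    diskToSimplex p y ∈ stdSimplex ℝ (Fin (p + 1)) :=
  (exists_disk_to_stdSimplex p).choose_spec.2.2.1 y

theorem mem_sphere_iff_diskToSimplex {p : ℕ}
    (y : Metric.closedBall (0 : EuclideanSpace ℝ (Fin p)) 1) :
    y.1 ∈ Metric.sphere 0 1 ↔ ∃ k, diskToSimplex p y k = 0 :=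
  (exists_disk_to_stdSimplex p).choose_spec.2.2.2.1 y

theorem exists_diskToSimplex_eq {p : ℕ} {t : Fin (p + 1) → ℝ}
    (ht : t ∈ stdSimplex ℝ (Fin (p + 1))) (hpos : ∀ k, 0 < t k) : ∃ y, diskToSimplex p y = t :=
  (exists_disk_to_stdSimplex p).choose_spec.2.2.2.2 t ht hpos

variable {I : Type u} [SmallCategory I] [FinCategory I] {S : Set I}

variable (S) in
/-- The `I`-space of points of dimension less than `n`. -/
noncomputable abbrev skeletonISpace (n : ℕ) : ISpace I :=
  (CompactSubfunctor.toISpaceFunctor _).obj (chainSubfunctor S n)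

omit [FinCategory I] in
theorem continuous_chainPoint_diskToSimplex {n : ℕ} (F : Fin (n + 1) ⥤ I) (j : I) :
    Continuous fun x : TopCat.discrete.{u}.obj (j ⟶ F.obj 0) ×
      Metric.closedBall (0 : EuclideanSpace ℝ (Fin n)) 1 =>
        chainPoint F x.1 (diskToSimplex n x.2) :=
  continuous_prod_of_discrete_left.mpr fun α =>
    (continuous_chainPoint F α).comp (continuous_diskToSimplex n)

/-- The characteristic map of the cell of a simple chain. -/
noncomputable def chainCellMap {n : ℕ} (F : {F : Fin (n + 1) ⥤ I // IsSimpleChain S F}) :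
    morProd (F.1.obj 0) (TopCat.disk.{u} n) ⟶ skeletonISpace S (n + 1) where
  app j := ObjectProperty.homMk (TopCat.ofHom
    ⟨fun x : (j.unop ⟶ F.1.obj 0) × ULift (Metric.closedBall (0 : EuclideanSpace ℝ (Fin n)) 1) =>
      (⟨chainPoint F.1 x.1 (diskToSimplex n x.2.down),
        n, n.lt_succ_self, F.1, F.2, x.1, _, diskToSimplex_mem _, rfl⟩ :
          chainSkeleton S (n + 1) j.unop), by
      exact Continuous.subtype_mk ((continuous_chainPoint_diskToSimplex F.1 j.unop).comp
        (continuous_id.prodMap continuous_uliftDown)) _⟩)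
  naturality j k f := by
    refine Spaces.hom_ext fun x => Subtype.ext ?_
    exact (chainSpaceFunctor_map_chainPoint F.1 f.unop _ _).symm

/-- The attaching map of the cell of a simple chain. -/
noncomputable def chainAttachingMap {n : ℕ} (F : {F : Fin (n + 1) ⥤ I // IsSimpleChain S F}) :
    morProd (F.1.obj 0) (TopCat.diskBoundary.{u} n) ⟶ skeletonISpace S n where
  app j := ObjectProperty.homMk (TopCat.ofHom
    ⟨fun x : (j.unop ⟶ F.1.obj 0) × ULift (Metric.sphere (0 : EuclideanSpace ℝ (Fin n)) 1) =>
      (⟨chainPoint F.1 x.1 (diskToSimplex n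
          ⟨x.2.down.1, Metric.sphere_subset_closedBall x.2.down.2⟩), by
          obtain ⟨k, hk⟩ := (mem_sphere_iff_diskToSimplex
            ⟨x.2.down.1, Metric.sphere_subset_closedBall x.2.down.2⟩).mp x.2.down.2
          exact chainPoint_mem_of_eq_zero F.2 x.1 (diskToSimplex_mem _) hk⟩ :
          chainSkeleton S n j.unop), by
      exact Continuous.subtype_mk ((continuous_chainPoint_diskToSimplex F.1 j.unop).comp
        (continuous_id.prodMap ((continuous_inclusion Metric.sphere_subset_closedBall).comp
          continuous_uliftDown))) _⟩)
  naturality j k f := by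
    refine Spaces.hom_ext fun x => Subtype.ext ?_
    exact (chainSpaceFunctor_map_chainPoint F.1 f.unop _ _).symm

variable (S) in
/-- The inclusion of successive skeleta attaches one cell for every simple chain. -/
noncomputable def chainAttachCells (n : ℕ) :
    AttachCells.{u} (basicICell I n)
      ((CompactSubfunctor.toISpaceFunctor _).map
        (homOfLE (chainSubfunctor_mono S (Nat.le_succ n)))) where
  ι := {F : Fin (n + 1) ⥤ I // IsSimpleChain S F}
  π F := F.1.obj 0
  cofan₁ := sigmaCofan _
  cofan₂ := sigmaCofan _
  isColimit₁ := sigmaCofanIsColimit _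
  isColimit₂ := sigmaCofanIsColimit _
  m := sigmaDesc fun F => basicICell I n (F.1.obj 0) ≫
    (sigmaCofan fun F : {F : Fin (n + 1) ⥤ I // IsSimpleChain S F} =>
      morProd (F.1.obj 0) (TopCat.disk.{u} n)).inj F
  hm F := by
    refine NatTrans.ext (funext fun j => ?_)
    rfl
  g₁ := sigmaDesc chainAttachingMap
  g₂ := sigmaDesc chainCellMap
  isPushout := by
    refine IsPushout.of_forall_isPushout_app fun j => ?_
    have hfin (F : {F : Fin (n + 1) ⥤ I // IsSimpleChain S F}) :
        CompactSpace ((morProd (F.1.obj 0) (TopCat.disk.{u} n)).obj j).obj := by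
      have : Finite (TopCat.discrete.obj (j.unop ⟶ F.1.obj 0)) :=
        inferInstanceAs (Finite (j.unop ⟶ F.1.obj 0))
      exact inferInstanceAs
        (CompactSpace (TopCat.discrete.obj (j.unop ⟶ F.1.obj 0) × TopCat.disk n))
    have : CompactSpace (((sigmaCofan fun F : {F : Fin (n + 1) ⥤ I // IsSimpleChain S F} =>
        morProd (F.1.obj 0) (TopCat.disk.{u} n)).pt).obj j).obj :=
      inferInstanceAs (CompactSpace (Σ F : {F : Fin (n + 1) ⥤ I // IsSimpleChain S F},
        ((morProd (F.1.obj 0) (TopCat.disk.{u} n)).obj j).obj))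
    have : CompactSpace ((skeletonISpace S n).obj j).obj :=
      isCompact_iff_compactSpace.mp (isCompact_chainSkeleton S n j.unop)
    refine Spaces.isPushout_of_compactSpace ?_ ?_ ?_ ?_ ?_
    · rfl
    · exact Set.inclusion_injective (chainSubfunctor_mono S (Nat.le_succ n) j)
    -- a point of the larger skeleton lies in an open `n`-simplex or in the smaller skeleton
    · rintro ⟨_, p, hp, F, hF, α, t, ht, rfl⟩
      by_cases hpos : p = n ∧ ∀ k, 0 < t k
      · obtain ⟨rfl, hpos⟩ := hpos
        obtain ⟨y, rfl⟩ := exists_diskToSimplex_eq ht hpos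
        exact .inr ⟨⟨⟨F, hF⟩, α, ⟨y⟩⟩, rfl⟩
      · refine .inl ⟨⟨chainPoint F α t, ?_⟩, rfl⟩
        rcases (Nat.lt_succ_iff.mp hp).lt_or_eq with hlt | rfl
        · exact ⟨p, hlt, F, hF, α, t, ht, rfl⟩
        · simp only [true_and, not_forall, not_lt] at hpos
          obtain ⟨k, hk⟩ := hpos
          exact chainPoint_mem_of_eq_zero hF α ht (le_antisymm hk (ht.1 k))
    -- a point of a closed cell that lies in the smaller skeleton comes from the boundary sphere
    · rintro ⟨x, p, hp, G, hG, β, s, hs, rfl⟩ ⟨F, α, ⟨y⟩⟩ h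
      have h' : chainPoint G β s = chainPoint F.1 α (diskToSimplex n y) := congrArg Subtype.val h
      have hy : ∃ k, diskToSimplex n y k = 0 := by
        by_contra! hne
        exact absurd (le_of_chainPoint_eq F.2.injective
          (fun k => ((diskToSimplex_mem y).1 k).lt_of_ne' (hne k)) h'.symm) (not_le.mpr hp)
      refine ⟨⟨F, α, ⟨⟨y.1, (mem_sphere_iff_diskToSimplex y).mpr hy⟩⟩⟩, Subtype.ext ?_, rfl⟩
      exact h'.symm
    -- distinct open cells are disjoint, and each is embedded
    · rintro ⟨F, α, ⟨y⟩⟩ ⟨G, β, ⟨z⟩⟩ h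
      have h' : chainPoint F.1 α (diskToSimplex n y) = chainPoint G.1 β (diskToSimplex n z) :=
        congrArg Subtype.val h
      by_cases hy : ∃ k, diskToSimplex n y k = 0
      · exact .inr ⟨⟨F, α, ⟨⟨y.1, (mem_sphere_iff_diskToSimplex y).mpr hy⟩⟩⟩, rfl⟩
      · left
        push Not at hy
        have hpos : ∀ k, 0 < diskToSimplex n y k :=
          fun k => ((diskToSimplex_mem y).1 k).lt_of_ne' (hy k)
        obtain rfl : F = G :=
          Subtype.ext (chain_eq_of_chainPoint_eq F.2.injective G.2.injective hpos h')
        obtain ⟨rfl, hyz⟩ := eq_of_chainPoint_eq F.2.injective hpos h'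
        obtain rfl := diskToSimplex_injective n hyz
        rfl

end AttachingCells

/-! ### The classifying space -/

section Representatives

/-- Choosing one object from each isomorphism class gives an antisymmetric set: in a scwol, a pair
of morphisms in opposite directions is an isomorphism. -/
theorem exists_isAntisymmSet (I : Type u) [SmallCategory I] [IsScwol I] :
    ∃ S : Set I, IsAntisymmSet S ∧ ∀ j, ∃ i ∈ S, Nonempty (j ≅ i) := by
  refine ⟨{i | (Quotient.mk (isIsomorphicSetoid I) i).out = i}, fun a ha b hb f g => ?_,
    fun j => ⟨(Quotient.mk (isIsomorphicSetoid I) j).out, ?_, ?_⟩⟩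
  · have : Quotient.mk (isIsomorphicSetoid I) a = Quotient.mk (isIsomorphicSetoid I) b :=
      Quotient.sound ⟨⟨f, g, IsScwol.endo_eq_id _, IsScwol.endo_eq_id _⟩⟩
    exact ha.symm.trans ((congrArg Quotient.out this).trans hb)
  · exact congrArg Quotient.out (Quotient.out_eq _)
  · exact Quotient.exact (Quotient.out_eq (Quotient.mk (isIsomorphicSetoid I) j)).symm

end Representatives

section ClassifyingSpace

variable {I : Type u} [SmallCategory I] [FinCategory I]

theorem chainSubfunctor_le_card (S : Set I) (n : ℕ) :
    chainSubfunctor S n ≤ chainSubfunctor S (Fintype.card I) :=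
  fun j => chainSkeleton_subset_card S n j.unop

/-- Simple chains have fewer morphisms than `I` has objects, so the skeleta are eventually
constant. -/
theorem isIso_toISpaceFunctor_map {S : Set I} {n m : ℕ}
    (h : chainSubfunctor S n ≤ chainSubfunctor S m) (h' : Fintype.card I ≤ n) :
    IsIso ((CompactSubfunctor.toISpaceFunctor _).map (homOfLE h)) := by
  have : IsIso (homOfLE h) := ⟨homOfLE ((chainSubfunctor_le_card S m).trans
    (chainSubfunctor_mono S h')), Subsingleton.elim _ _, Subsingleton.elim _ _⟩
  infer_instance

/-- The `I`-CW-structure whose cells are the simple chains in `S`. -/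
noncomputable def chainCWComplex (S : Set I) : ICWComplex (skeletonISpace S (Fintype.card I)) where
  sk := (chainSubfunctor_mono S).functor ⋙ CompactSubfunctor.toISpaceFunctor _
  incl :=
    { app n := (CompactSubfunctor.toISpaceFunctor _).map (homOfLE (chainSubfunctor_le_card S n))
      naturality _ _ _ := rfl }
  isEmbedding n i := IsEmbedding.inclusion (chainSubfunctor_le_card S n _)
  isEmpty i := ⟨fun ⟨_, _, h, _⟩ => absurd h (Nat.not_lt_zero _)⟩
  isColimit := by
    have h : ((chainSubfunctor_mono S).functor ⋙
        CompactSubfunctor.toISpaceFunctor _).IsEventuallyConstantFrom (Fintype.card I) :=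
      fun m f => isIso_toISpaceFunctor_map (chainSubfunctor_mono S (leOfHom f)) le_rfl
    refine @Functor.IsEventuallyConstantFrom.isColimitOfIsIso _ _ _ _ _ _ h _ _ ?_
    exact isIso_toISpaceFunctor_map (chainSubfunctor_le_card S _) le_rfl
  attachCells n := chainAttachCells S n

theorem isFinite_chainCWComplex (S : Set I) : (chainCWComplex S).IsFinite where
  finiteDimensional :=
    ⟨Fintype.card I, isIso_toISpaceFunctor_map (chainSubfunctor_le_card S _) le_rfl⟩
  finite_cells n := inferInstanceAs (Finite {F : Fin (n + 1) ⥤ I // IsSimpleChain S F})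

/-- The value at an object of `S` is a cone; every other value is homeomorphic to such a one. -/
theorem isClassifyingModel_chainCWComplex [IsScwol I] {S : Set I} (hS : IsAntisymmSet S)
    (hrep : ∀ j, ∃ i ∈ S, Nonempty (j ≅ i)) : (chainCWComplex S).IsClassifyingModel := by
  intro j
  obtain ⟨i, hi, ⟨e⟩⟩ := hrep j
  have : ContractibleSpace (isSteenrodSpace.ι.obj
      ((skeletonISpace S (Fintype.card I)).obj (.op i))) :=
    contractibleSpace_chainSkeleton hS hi
  exact (TopCat.homeoOfIso (isSteenrodSpace.ι.mapIso
    ((skeletonISpace S (Fintype.card I)).mapIso e.op))).symm.contractibleSpace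

end ClassifyingSpace

theorem mainTheorem7 (I : Type u) [SmallCategory I] [FinCategory I] [IsScwol I] :
    ∃ (X : ISpace I) (c : ICWComplex X), c.IsFinite ∧ c.IsClassifyingModel := by
  obtain ⟨S, hS, hrep⟩ := exists_isAntisymmSet I
  exact ⟨_, chainCWComplex S, isFinite_chainCWComplex S,
    isClassifyingModel_chainCWComplex hS hrep⟩
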